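/- Let $\Sigma$ be a finite nonempty alphabet and $S$ a finite set. Write $\mathbb N^{\Sigma^*}$ for the set of functions $\Sigma^*\to\mathbb N$ (multisets of words) with the product $\sigma$-algebra, and let $\mathcal S(\mathbb N^{\Sigma^*})$ be the $\mathbb R$-algebra of finite signed measures on it, with multiplication $\mu\mathbin{\&}\nu$ the pushforward of $\mu\otimes\nu$ under pointwise addition and unit the point mass at $0$. A word $x$ acts on multisets by $(x\cdot\alpha)(xz)=\alpha(z)$ and $(x\cdot\alpha)(y)=0$ if $x$ is not a prefix of $y$, and on measures by pushforward; put $\epsilon=\delta_{\{\varepsilon\}}$, where $\varepsilon$ is the empty word. Let $F=\mathbb R[\Sigma^*\cdot\epsilon,\Sigma^*\cdot S]$ be the polynomial algebra in the indeterminates $x\cdot\epsilon$ and $x\cdot s$ ($x\in\Sigma^*$, $s\in S$), on which words act by $x\cdot(y\cdot\epsilon)=xy\cdot\epsilon$, $x\cdot(y\cdot s)=xy\cdot s$; identify $s$ with $\varepsilon\cdot s$ and $\epsilon$ with $\varepsilon\cdot\epsilon$. For an $\mathbb R$-algebra $V$ with an action of $\Sigma^*$ by algebra endomorphisms and a distinguished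 element $\epsilon$, a map $f:S\to V$ extends to the algebra homomorphism $f^\ddagger:F\to V$ with $f^\ddagger(x\cdot\epsilon)=x\cdot\epsilon$ and $f^\ddagger(x\cdot s)=x\cdot f(s)$. Let $\mathbb 1:F\to\mathbb R$ map every indeterminate to $1$. An automaton with state set $S$ is a map $\theta:S\to\mathbb R[\epsilon,\Sigma\cdot S]\subseteq F$ such that each $\theta(s)$ has nonnegative coefficients with sum $1$. Its semantics is the map $\llbracket-\rrbracket$ from $S$ to the probability measures on $\mathbb N^{\Sigma^*}$ with $\llbracket s\rrbracket=\llbracket-\rrbracket^\ddagger(\theta(s))$ for all $s\in S$. Let $\mathcal S(\mathbb N^S)$ be the $\mathbb R$-algebra (with the operations defined as above) of signed measures with finite support on $\mathbb N^S$, and $\phi_S:\mathbb R[S]\to\mathcal S(\mathbb N^S)$ the algebra isomorphism with $\phi_S(s)=\delta_{\{s\}}$; for $\mu\in\mathcal S(\mathbb N^S)$ put $\llbracket\mu\rrbracket=\llbracket-\rrbracket^\ddagger(\phi_S^{-1}(\mu))$. A finite tree is a finite prefix-closed set $A\subseteq\Sigma^*$, and $\partial A$ is the set of prefix-minimal elements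 of $\Sigma^*\setminus A$. For $x\in\Sigma^*$ let $x\cdot\theta:F\to F$ be the algebra homomorphism that maps $xz\cdot s$ to $xz\cdot\theta(s)$ for $z\in\Sigma^*$, $s\in S$, and fixes all other indeterminates. Algebra homomorphisms $\theta_A:\mathbb R[S]\to\mathbb R[A\cdot\epsilon,\partial A\cdot S]$ are defined by $\theta_\emptyset=\mathrm{id}$ and $\theta_{A\cup\{x\}}=(x\cdot\theta)\circ\theta_A$ for $x\in\partial A$. For a monomial $m$ in the indeterminates $y\cdot\epsilon$, $y\in A$, let $d_A^m(p)\in\mathbb R[\partial A\cdot S]$ be the coefficient of $m$ in $\theta_A(p)$, so $\theta_A(p)=\sum_m d_A^m(p)\,m$; for $x\in\partial A$ let $d_{A,x}^m(p)\in\mathbb R[S]$ be the polynomial for which $x\cdot d_{A,x}^m(p)$ is obtained from $d_A^m(p)$ by substituting $1$ for all $y\cdot s$ with $y\in\partial A\setminus\{x\}$, $s\in S$. Theorem. For every automaton $\theta:S\to\mathbb R[\epsilon,\Sigma\cdot S]$ the semantics $\llbracket-\rrbracket$ exists and is unique. For all $\mu,\nu\in\mathcal S(\mathbb N^S)$, with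 $p=\phi_S^{-1}(\mu-\nu)\in\mathbb R[S]$, one has $\llbracket\mu\rrbracket=\llbracket\nu\rrbracket$ if and only if, for all finite trees $A\subseteq\Sigma^*$, all $x\in\partial A$ and all monomials $m$ in the indeterminates $y\cdot\epsilon$, $y\in A$, $$d_{A,x}^m(p)\in\ker\mathbb 1 .$$ -/

import Mathlib

open MeasureTheory

namespace PKA

noncomputable section

section SignedMeasures

set_option linter.unusedSectionVars false

variable {X Y : Type*} [MeasurableSpace X] [MeasurableSpace Y]

instance instFiniteVariation (μ : SignedMeasure X) : IsFiniteMeasure μ.variation := by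
  rw [← SignedMeasure.totalVariation_eq_variation]
  infer_instance

/-- The independent product `μ ⊗ ν` of two finite signed measures. -/
def tensor (μ : SignedMeasure X) (ν : SignedMeasure Y) : SignedMeasure (X × Y) :=
  VectorMeasure.prod μ ν (ContinuousLinearMap.mul ℝ ℝ)

theorem tensor_apply (μ : SignedMeasure X) (ν : SignedMeasure Y) (s : Set X) (t : Set Y) :
    tensor μ ν (s ×ˢ t) = μ s * ν t := by
  simp [tensor]

theorem tensor_eq {μ : SignedMeasure X} {ν : SignedMeasure Y} {ρ : SignedMeasure (X × Y)}
    (h : ∀ s t, MeasurableSet s → MeasurableSet t → ρ (s ×ˢ t) = μ s * ν t) :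
    tensor μ ν = ρ :=
  VectorMeasure.prod_eq_of_forall_apply_prod (by simpa using h)

theorem map_map {Z : Type*} [MeasurableSpace Z] (μ : SignedMeasure X) {f : X → Y} {g : Y → Z}
    (hf : Measurable f) (hg : Measurable g) : (μ.map f).map g = μ.map (g ∘ f) := by
  ext s hs
  rw [VectorMeasure.map_apply _ hg hs, VectorMeasure.map_apply _ hf (hg hs),
    VectorMeasure.map_apply _ (hg.comp hf) hs, Set.preimage_comp]

theorem map_dirac {f : X → Y} (hf : Measurable f) (x : X) (r : ℝ) :
    (VectorMeasure.dirac x r).map f = VectorMeasure.dirac (f x) r := by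
  ext s hs
  rw [VectorMeasure.map_apply _ hf hs]
  by_cases h : f x ∈ s
  · rw [VectorMeasure.dirac_apply_of_mem (hf hs) h, VectorMeasure.dirac_apply_of_mem hs h]
  · rw [VectorMeasure.dirac_apply_of_notMem (by exact h), VectorMeasure.dirac_apply_of_notMem h]

theorem tensor_map {X' Y' : Type*} [MeasurableSpace X'] [MeasurableSpace Y']
    (μ : SignedMeasure X) (ν : SignedMeasure Y) {f : X → X'} {g : Y → Y'}
    (hf : Measurable f) (hg : Measurable g) :
    tensor (μ.map f) (ν.map g) = (tensor μ ν).map (Prod.map f g) := by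
  refine tensor_eq fun s t hs ht => ?_
  rw [VectorMeasure.map_apply _ (hf.prodMap hg) (hs.prod ht), VectorMeasure.map_apply _ hf hs,
    VectorMeasure.map_apply _ hg ht, Set.preimage_prod_map_prod, tensor_apply]

theorem tensor_dirac (x : X) (y : Y) (r s : ℝ) :
    tensor (VectorMeasure.dirac x r) (VectorMeasure.dirac y s) =
      VectorMeasure.dirac (x, y) (r * s) := by
  refine tensor_eq fun a b ha hb => ?_
  by_cases h₁ : x ∈ a
  · by_cases h₂ : y ∈ b
    · rw [VectorMeasure.dirac_apply_of_mem (ha.prod hb) ⟨h₁, h₂⟩,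
        VectorMeasure.dirac_apply_of_mem ha h₁, VectorMeasure.dirac_apply_of_mem hb h₂]
    · rw [VectorMeasure.dirac_apply_of_notMem (fun h => h₂ h.2),
        VectorMeasure.dirac_apply_of_notMem h₂, mul_zero]
  · rw [VectorMeasure.dirac_apply_of_notMem (fun h => h₁ h.1),
      VectorMeasure.dirac_apply_of_notMem h₁, zero_mul]

theorem tensor_add (μ : SignedMeasure X) (ν ρ : SignedMeasure Y) :
    tensor μ (ν + ρ) = tensor μ ν + tensor μ ρ :=
  tensor_eq fun s t _ _ => by simp [tensor_apply, mul_add]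

theorem tensor_smul (r : ℝ) (μ : SignedMeasure X) (ν : SignedMeasure Y) :
    tensor μ (r • ν) = r • tensor μ ν :=
  tensor_eq fun s t _ _ => by simp [tensor_apply]; ring

theorem tensor_swap (μ : SignedMeasure X) (ν : SignedMeasure Y) :
    tensor ν μ = (tensor μ ν).map Prod.swap :=
  tensor_eq fun s t hs ht => by
    rw [VectorMeasure.map_apply _ measurable_swap (hs.prod ht), Set.preimage_swap_prod,
      tensor_apply, mul_comm]

theorem tensor_assoc {Z : Type*} [MeasurableSpace Z] (μ : SignedMeasure X) (ν : SignedMeasure Y)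
    (ρ : SignedMeasure Z) :
    tensor μ (tensor ν ρ) = (tensor (tensor μ ν) ρ).map MeasurableEquiv.prodAssoc := by
  have hm := (MeasurableEquiv.prodAssoc (α := X) (β := Y) (γ := Z)).measurable
  refine VectorMeasure.ext_of_generateFrom
    (Set.image2 (fun s u => s ×ˢ u) {s : Set X | MeasurableSet s}
      (Set.image2 (fun t u => t ×ˢ u) {t : Set Y | MeasurableSet t} {u : Set Z | MeasurableSet u}))
    ?_ ?_ ?_ ?_
  · rintro _ ⟨s, hs, _, ⟨t, ht, u, hu, rfl⟩, rfl⟩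
    simp only [Set.mem_ofPred_eq] at hs ht hu
    rw [VectorMeasure.map_apply _ hm (hs.prod (ht.prod hu))]
    have : MeasurableEquiv.prodAssoc ⁻¹' (s ×ˢ t ×ˢ u) = (s ×ˢ t) ×ˢ u := by
      ext ⟨⟨a, b⟩, c⟩; simp [MeasurableEquiv.prodAssoc, and_assoc]
    rw [this]
    simp only [tensor_apply]
    ring
  · refine (generateFrom_eq_prod MeasurableSpace.generateFrom_measurableSet generateFrom_prod
      ?_ ?_).symm
    · exact ⟨fun _ => Set.univ, fun _ => MeasurableSet.univ, Set.iUnion_const _⟩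
    · exact ⟨fun _ => Set.univ, fun _ => ⟨Set.univ, MeasurableSet.univ, Set.univ,
        MeasurableSet.univ, Set.univ_prod_univ⟩, Set.iUnion_const _⟩
  · exact MeasurableSpace.isPiSystem_measurableSet.prod isPiSystem_prod
  · rw [VectorMeasure.map_apply _ hm MeasurableSet.univ, Set.preimage_univ]
    simp only [← Set.univ_prod_univ, tensor_apply]
    ring

variable [AddCommMonoid X] [MeasurableAdd₂ X] [AddCommMonoid Y] [MeasurableAdd₂ Y]

theorem measurable_sum_pair : Measurable fun z : X × X => z.1 + z.2 :=
  measurable_fst.add measurable_snd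

/-- Nondeterministic choice `μ & ν`: the pushforward of `μ ⊗ ν` under addition. When `X` is a
space of multisets (functions to `ℕ`), addition is multiset union. -/
def choice (μ ν : SignedMeasure X) : SignedMeasure X :=
  (tensor μ ν).map fun z => z.1 + z.2

theorem choice_comm (μ ν : SignedMeasure X) : choice μ ν = choice ν μ := by
  unfold choice
  rw [tensor_swap μ ν, map_map _ measurable_swap measurable_sum_pair]
  congr 1
  ext z
  exact add_comm _ _

theorem choice_add (μ ν ρ : SignedMeasure X) :
    choice μ (ν + ρ) = choice μ ν + choice μ ρ := by
  simp only [choice, tensor_add, VectorMeasure.map_add]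

theorem choice_smul (r : ℝ) (μ ν : SignedMeasure X) : choice μ (r • ν) = r • choice μ ν := by
  simp only [choice, tensor_smul, VectorMeasure.map_smul]

theorem choice_zero (μ : SignedMeasure X) : choice μ 0 = 0 := by
  simpa using choice_smul 0 μ 0

theorem choice_dirac (x y : X) (r s : ℝ) :
    choice (VectorMeasure.dirac x r) (VectorMeasure.dirac y s) =
      VectorMeasure.dirac (x + y) (r * s) := by
  rw [choice, tensor_dirac, map_dirac measurable_sum_pair]

theorem one_choice (μ : SignedMeasure X) : choice (VectorMeasure.dirac 0 1) μ = μ := by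
  have h : tensor (VectorMeasure.dirac (0 : X) (1 : ℝ)) μ = μ.map fun x => ((0 : X), x) := by
    refine tensor_eq fun s t hs ht => ?_
    rw [VectorMeasure.map_apply _ measurable_prodMk_left (hs.prod ht)]
    by_cases h : (0 : X) ∈ s
    · rw [VectorMeasure.dirac_apply_of_mem hs h, one_mul]
      congr 1
      ext; simp [h]
    · rw [VectorMeasure.dirac_apply_of_notMem h, zero_mul]
      have : (fun x : X => ((0 : X), x)) ⁻¹' s ×ˢ t = ∅ := by ext; simp [h]
      rw [this, VectorMeasure.empty]
  rw [choice, h, map_map _ measurable_prodMk_left measurable_sum_pair]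
  have : ((fun z : X × X => z.1 + z.2) ∘ fun x => ((0 : X), x)) = id := by ext; simp
  rw [this, VectorMeasure.map_id]

theorem choice_assoc (μ ν ρ : SignedMeasure X) :
    choice (choice μ ν) ρ = choice μ (choice ν ρ) := by
  have h₁ := tensor_map (tensor μ ν) ρ (measurable_sum_pair (X := X)) measurable_id
  have h₂ := tensor_map μ (tensor ν ρ) measurable_id (measurable_sum_pair (X := X))
  rw [VectorMeasure.map_id] at h₁ h₂
  unfold choice
  rw [h₁, h₂, tensor_assoc, map_map _ (measurable_sum_pair.prodMap measurable_id)
      measurable_sum_pair, map_map _ MeasurableEquiv.prodAssoc.measurable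
      (measurable_id.prodMap measurable_sum_pair), map_map _
      ((measurable_id.prodMap measurable_sum_pair).comp MeasurableEquiv.prodAssoc.measurable)
      measurable_sum_pair]
  congr 1
  ext ⟨⟨a, b⟩, c⟩
  exact add_assoc a b c

/-- The algebra of finite signed measures: pointwise vector space operations, multiplication
`&`, unit the point mass at the empty multiset `0`. -/
instance instCommRingSignedMeasure : CommRing (SignedMeasure X) where
  __ := (inferInstance : AddCommGroup (SignedMeasure X))
  mul := choice
  one := VectorMeasure.dirac 0 1
  mul_assoc := choice_assoc
  one_mul := one_choice
  mul_one μ := (choice_comm _ _).trans (one_choice μ)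
  left_distrib := choice_add
  right_distrib μ ν ρ := by
    change choice (μ + ν) ρ = choice μ ρ + choice ν ρ
    rw [choice_comm, choice_add, choice_comm ρ, choice_comm ρ]
  zero_mul μ := by
    change choice 0 μ = 0
    rw [choice_comm, choice_zero]
  mul_zero := choice_zero
  mul_comm := choice_comm

instance instAlgebraSignedMeasure : Algebra ℝ (SignedMeasure X) :=
  Algebra.ofModule
    (fun r μ ν => by
      change choice (r • μ) ν = r • choice μ ν
      rw [choice_comm, choice_smul, choice_comm])
    (fun r μ ν => choice_smul r μ ν)

theorem dirac_mul (x y : X) (r s : ℝ) :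
    (VectorMeasure.dirac x r * VectorMeasure.dirac y s : SignedMeasure X) =
      VectorMeasure.dirac (x + y) (r * s) :=
  choice_dirac x y r s

/-- Pushforward of signed measures along a measurable additive map. -/
def pushforward (f : X →+ Y) (hf : Measurable f) : SignedMeasure X →ₐ[ℝ] SignedMeasure Y :=
  AlgHom.ofLinearMap (VectorMeasure.mapₗ f)
    (by
      change (VectorMeasure.dirac (0 : X) (1 : ℝ)).map f = VectorMeasure.dirac 0 1
      rw [map_dirac hf, map_zero])
    (fun μ ν => by
      change (choice μ ν).map f = choice (μ.map f) (ν.map f)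
      unfold choice
      rw [tensor_map _ _ hf hf, map_map _ measurable_sum_pair hf,
        map_map _ (hf.prodMap hf) measurable_sum_pair]
      congr 1
      ext z
      exact map_add f _ _)

theorem pushforward_apply (f : X →+ Y) (hf : Measurable f) (μ : SignedMeasure X) :
    pushforward f hf μ = μ.map f := rfl

end SignedMeasures

section FiniteSupport

variable (S : Type*) [Finite S]

open scoped Classical in
theorem eq_sum_dirac {S : Type*} [Finite S] (μ : SignedMeasure (S → ℕ))
    (h : {m | μ {m} ≠ 0}.Finite) :
    μ = ∑ m ∈ h.toFinset, VectorMeasure.dirac m (μ {m}) := by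
  have key : ∀ B : Set (S → ℕ), HasSum (fun m => if m ∈ B then μ {m} else 0) (μ B) := by
    intro B
    have hB : (⋃ m : S → ℕ, {m} ∩ B) = B := by ext; simp
    have := VectorMeasure.hasSum_of_disjoint_iUnion (v := μ) (f := fun m : S → ℕ => {m} ∩ B)
      (fun m => (Set.to_countable _).measurableSet)
      (fun a b hab => by
        simp only [Function.onFun]
        exact (Set.disjoint_singleton.2 hab).mono Set.inter_subset_left Set.inter_subset_left)
    rw [hB] at this
    convert this using 2 with m
    split_ifs with hm
    · congr 1; ext; simp; rintro rfl; exact hm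
    · have : ({m} ∩ B : Set (S → ℕ)) = ∅ := by ext; simp; rintro rfl; exact hm
      rw [this, VectorMeasure.empty]
  ext B hB
  refine (key B).unique ?_
  have h2 : (∑ m ∈ h.toFinset, VectorMeasure.dirac m (μ {m})) B =
      ∑ m ∈ h.toFinset, if m ∈ B then μ {m} else 0 := by
    have hs : ∀ F : Finset (S → ℕ), (∑ m ∈ F, VectorMeasure.dirac m (μ {m})) B =
        ∑ m ∈ F, (VectorMeasure.dirac m (μ {m}) : SignedMeasure (S → ℕ)) B := by
      intro F
      induction F using Finset.induction_on with
      | empty => simp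
      | insert a F ha ih => rw [Finset.sum_insert ha, Finset.sum_insert ha, ← ih]; rfl
    rw [hs]
    refine Finset.sum_congr rfl fun m _ => ?_
    split_ifs with hm
    · exact VectorMeasure.dirac_apply_of_mem hB hm
    · exact VectorMeasure.dirac_apply_of_notMem hm
  rw [h2]
  refine hasSum_sum_of_ne_finset_zero fun m hm => ?_
  simp only [Set.Finite.mem_toFinset, Set.mem_ofPred_eq, not_not] at hm
  simp [hm]

theorem dirac_eq_smul {X : Type*} [MeasurableSpace X] (x : X) (r : ℝ) :
    (VectorMeasure.dirac x r : SignedMeasure X) = r • VectorMeasure.dirac x 1 := by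
  ext B hB
  by_cases h : x ∈ B
  · simp [VectorMeasure.dirac_apply_of_mem hB h]
  · simp [VectorMeasure.dirac_apply_of_notMem h]

theorem finite_support_dirac {S : Type*} [Finite S] (x : S → ℕ) (r : ℝ) :
    {m | (VectorMeasure.dirac x r : SignedMeasure (S → ℕ)) {m} ≠ 0}.Finite :=
  (Set.finite_singleton x).subset fun m hm => by
    by_contra h
    exact hm (VectorMeasure.dirac_apply_of_notMem fun h' => h (by simpa using h'.symm))

theorem finite_support_add {S : Type*} {μ ν : SignedMeasure (S → ℕ)}
    (hμ : {m | μ {m} ≠ 0}.Finite) (hν : {m | ν {m} ≠ 0}.Finite) :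
    {m | (μ + ν) {m} ≠ 0}.Finite :=
  (hμ.union hν).subset fun m hm => by
    by_contra h
    simp only [Set.mem_union, Set.mem_ofPred_eq, not_or, not_not] at h
    exact hm (by simp [h.1, h.2])

theorem finite_support_sum {S : Type*} {ι : Type*} (F : Finset ι)
    (μ : ι → SignedMeasure (S → ℕ)) (h : ∀ i ∈ F, {m | μ i {m} ≠ 0}.Finite) :
    {m | (∑ i ∈ F, μ i) {m} ≠ 0}.Finite := by
  classical
  induction F using Finset.induction_on with
  | empty => simp
  | insert a F ha ih =>
    rw [Finset.sum_insert ha]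
    exact finite_support_add (h a (by simp)) (ih fun i hi => h i (by simp [hi]))

/-- The algebra of finite signed measures on `ℕ^S` with finite support. -/
def FinSupp : Subalgebra ℝ (SignedMeasure (S → ℕ)) where
  carrier := {μ | {m | μ {m} ≠ 0}.Finite}
  mul_mem' := by
    intro μ ν hμ hν
    change {m | (μ * ν) {m} ≠ 0}.Finite
    rw [eq_sum_dirac μ hμ, eq_sum_dirac ν hν, Finset.sum_mul_sum]
    refine finite_support_sum _ _ fun i _ => finite_support_sum _ _ fun j _ => ?_
    rw [dirac_mul]
    exact finite_support_dirac _ _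
  add_mem' := finite_support_add
  algebraMap_mem' r := by
    rw [Algebra.algebraMap_eq_smul_one]
    change {m | (r • VectorMeasure.dirac 0 1 : SignedMeasure (S → ℕ)) {m} ≠ 0}.Finite
    rw [← dirac_eq_smul]
    exact finite_support_dirac _ _

open scoped Classical in
/-- The algebra morphism `φ_S` from `ℝ[S]` that maps `s` to the point mass at the one-element
multiset `{s}`. -/
def phiHom : MvPolynomial S ℝ →ₐ[ℝ] FinSupp S :=
  MvPolynomial.aeval fun s => ⟨VectorMeasure.dirac (Pi.single s 1) 1, finite_support_dirac _ _⟩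

theorem dirac_pow {X : Type*} [MeasurableSpace X] [AddCommMonoid X] [MeasurableAdd₂ X]
    (x : X) (k : ℕ) :
    (VectorMeasure.dirac x 1 : SignedMeasure X) ^ k = VectorMeasure.dirac (k • x) 1 := by
  induction k with
  | zero => rw [pow_zero, zero_smul]; rfl
  | succ k ih => rw [pow_succ, ih, dirac_mul, one_mul, succ_nsmul]

theorem phiHom_monomial (m : S →₀ ℕ) (r : ℝ) :
    (phiHom S (MvPolynomial.monomial m r) : SignedMeasure (S → ℕ)) =
      VectorMeasure.dirac (m : S → ℕ) r := by
  classical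
  induction m using Finsupp.induction generalizing r with
  | zero =>
    rw [← MvPolynomial.C_apply, ← MvPolynomial.algebraMap_eq, AlgHom.commutes,
      Subalgebra.coe_algebraMap, Algebra.algebraMap_eq_smul_one, dirac_eq_smul]
    rfl
  | single_add s k m _ _ ih =>
    have : MvPolynomial.monomial (Finsupp.single s k + m) r =
        (MvPolynomial.X s) ^ k * MvPolynomial.monomial m r := by
      rw [MvPolynomial.X_pow_eq_monomial, MvPolynomial.monomial_mul, one_mul]
    rw [this, map_mul, map_pow, Subalgebra.coe_mul, ih, Subalgebra.coe_pow]
    have h2 : (phiHom S (MvPolynomial.X s) : SignedMeasure (S → ℕ)) =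
        VectorMeasure.dirac (Pi.single s 1) 1 := by
      simp only [phiHom, MvPolynomial.aeval_X]
    rw [h2, dirac_pow, dirac_mul, one_mul]
    congr 1
    ext t
    by_cases h : t = s
    · subst h; simp
    · simp [h]

theorem phiHom_apply (p : MvPolynomial S ℝ) (m : S →₀ ℕ) :
    (phiHom S p : SignedMeasure (S → ℕ)) {(m : S → ℕ)} = p.coeff m := by
  classical
  induction p using MvPolynomial.induction_on' with
  | monomial u a =>
    rw [phiHom_monomial, MvPolynomial.coeff_monomial]
    split_ifs with h
    · exact VectorMeasure.dirac_apply_of_mem (measurableSet_singleton _) (by simp [h])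
    · exact VectorMeasure.dirac_apply_of_notMem (by simpa [DFunLike.coe_fn_eq] using h)
  | add p q hp hq => rw [map_add, MvPolynomial.coeff_add, ← hp, ← hq]; rfl

theorem phiHom_bijective : Function.Bijective (phiHom S) := by
  constructor
  · intro p q h
    ext m
    rw [← phiHom_apply, ← phiHom_apply, h]
  · rintro ⟨μ, hμ⟩
    refine ⟨∑ m ∈ Set.Finite.toFinset hμ,
      MvPolynomial.monomial (Finsupp.equivFunOnFinite.symm m) (μ {m}), Subtype.ext ?_⟩
    rw [map_sum, AddSubmonoidClass.coe_finsetSum]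
    refine Eq.trans ?_ (eq_sum_dirac μ hμ).symm
    refine Finset.sum_congr rfl fun m _ => ?_
    rw [phiHom_monomial]
    rfl

/-- The isomorphism `φ_S` between `ℝ[S]` and the finitely supported signed measures on `ℕ^S`. -/
def phi : MvPolynomial S ℝ ≃ₐ[ℝ] FinSupp S :=
  AlgEquiv.ofBijective (phiHom S) (phiHom_bijective S)

end FiniteSupport

section WordAlgebras

/-- An algebra over `ℝ` with an action of the word monoid `Λ^*` by algebra endomorphisms and a
distinguished element `ε`. -/
class WordAlgebra (Λ : Type*) (V : Type*) [CommRing V] [Algebra ℝ V] where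
  act : List Λ → V →ₐ[ℝ] V
  act_nil : act [] = AlgHom.id ℝ V
  act_append : ∀ x y, act (x ++ y) = (act x).comp (act y)
  eps : V

variable {Λ : Type*} {S : Type*}

/-- The action of a word on multisets of words: `(x · α)(x z) = α z`, and `x · α` vanishes
on words that do not have `x` as a prefix. -/
def shift (x : List Λ) : (List Λ → ℕ) →+ (List Λ → ℕ) where
  toFun α y := open scoped Classical in if x <+: y then α (y.drop x.length) else 0
  map_zero' := by ext; simp
  map_add' α β := by
    ext y
    simp only [Pi.add_apply]
    split_ifs <;> rfl

theorem measurable_shift (x : List Λ) : Measurable (shift x) := by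
  classical
  refine measurable_pi_lambda _ fun y => ?_
  change Measurable fun α : List Λ → ℕ => if x <+: y then α (y.drop x.length) else 0
  split_ifs
  · exact measurable_pi_apply _
  · exact measurable_const

theorem shift_append (x y : List Λ) (α : List Λ → ℕ) :
    shift (x ++ y) α = shift x (shift y α) := by
  classical
  ext w
  change (if x ++ y <+: w then α (w.drop (x ++ y).length) else 0) =
    if x <+: w then (if y <+: w.drop x.length then α ((w.drop x.length).drop y.length) else 0)
      else 0
  by_cases h : x <+: w
  · obtain ⟨z, rfl⟩ := h
    simp [List.prefix_append_right_inj]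
  · rw [if_neg h, if_neg fun h' => h ((List.prefix_append x y).trans h')]

/-- The algebra of finite signed measures on multisets of words, with `x · μ` the pushforward
of `μ` under `x · -`, and `ε` the point mass at the multiset `{[]}`. The product σ-algebra on
`List Λ → ℕ` is the one generated by the sets of multisets with prescribed values on a finite
tree. -/
instance instWordAlgebraSignedMeasure : WordAlgebra Λ (SignedMeasure (List Λ → ℕ)) where
  act x := pushforward (shift x) (measurable_shift x)
  act_nil := by
    ext1 μ
    have : (shift ([] : List Λ) : (List Λ → ℕ) → (List Λ → ℕ)) = id := by
      ext α y; simp [shift]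
    rw [pushforward_apply, this, VectorMeasure.map_id]
    rfl
  act_append x y := by
    ext1 μ
    rw [AlgHom.comp_apply, pushforward_apply, pushforward_apply, pushforward_apply,
      map_map _ (measurable_shift y) (measurable_shift x)]
    congr 1
    ext1 α
    exact shift_append x y α
  eps := open scoped Classical in VectorMeasure.dirac (Pi.single [] 1) 1

/-- The real numbers with the trivial action and `ε = 1`. -/
instance instWordAlgebraReal : WordAlgebra Λ ℝ where
  act _ := AlgHom.id ℝ ℝ
  act_nil := rfl
  act_append _ _ := rfl
  eps := 1

/-- The polynomials in the indeterminates `x · ε` (written `Sum.inl x`) and `x · s`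
(written `Sum.inr (x, s)`), for words `x` and `s ∈ S`. -/
abbrev Free (Λ S : Type*) := MvPolynomial (List Λ ⊕ (List Λ × S)) ℝ

/-- The free word algebra on `S`: words act on the indeterminates by concatenation. -/
instance instWordAlgebraFree : WordAlgebra Λ (Free Λ S) where
  act x := MvPolynomial.rename (Sum.map (fun y => x ++ y) (fun z => (x ++ z.1, z.2)))
  act_nil := by
    ext i
    rcases i with i | i <;> simp
  act_append x y := by
    ext i
    rcases i with i | i <;> simp
  eps := MvPolynomial.X (Sum.inl [])

/-- The morphism `f^‡` of word algebras from the free algebra extending `f : S → V`. -/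
def lift {V : Type*} [CommRing V] [Algebra ℝ V] [WordAlgebra Λ V] (f : S → V) :
    Free Λ S →ₐ[ℝ] V :=
  MvPolynomial.aeval (Sum.elim (fun x => WordAlgebra.act x (WordAlgebra.eps Λ))
    (fun z => WordAlgebra.act z.1 (f z.2)))

/-- The inclusion of `ℝ[S]` in the free word algebra. -/
def incl (Λ S : Type*) : MvPolynomial S ℝ →ₐ[ℝ] Free Λ S :=
  MvPolynomial.rename fun s => Sum.inr ([], s)

/-- The morphism `𝟙` of word algebras that maps every `s ∈ S` to `1`. -/
def bone (Λ S : Type*) : Free Λ S →ₐ[ℝ] ℝ :=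
  lift fun _ => 1

/-- The partial evaluation `B · h`, with values in `V[Λ^* · S]`: it maps `x · z` to `x · h(z)` for
`x ∈ B` and `z ∈ Λ^* · S`, and `y · ε` to `h(y · ε)`, and fixes the other indeterminates. The
word `x` is unique when the words in `B` are pairwise prefix-incomparable. -/
def partialEval {V : Type*} [CommRing V] [Algebra ℝ V] [WordAlgebra Λ V]
    (B : Set (List Λ)) (h : Free Λ S →ₐ[ℝ] V) :
    Free Λ S →ₐ[ℝ] MvPolynomial (List Λ × S) V :=
  open scoped Classical in
  MvPolynomial.aeval (Sum.elim (fun y => MvPolynomial.C (h (MvPolynomial.X (Sum.inl y))))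
    (fun w => if H : ∃ x ∈ B, x <+: w.1 then
        MvPolynomial.C (WordAlgebra.act H.choose
          (h (MvPolynomial.X (Sum.inr (w.1.drop H.choose.length, w.2)))))
      else MvPolynomial.X w))

/-- The identification of the indeterminates of `V[Λ^* · S]` with elements of `V` when `V` is
the free word algebra on `S`. -/
def flatten : MvPolynomial (List Λ × S) (Free Λ S) →ₐ[ℝ] Free Λ S :=
  (MvPolynomial.aeval (R := Free Λ S) fun w => MvPolynomial.X (Sum.inr w)).restrictScalars ℝ

end WordAlgebras

section Trees

variable {Λ : Type*}

/-- Finite trees: finite prefix-closed sets of words. -/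
def IsTree (A : Finset (List Λ)) : Prop :=
  ∀ x ∈ A, ∀ y, y <+: x → y ∈ A

/-- `∂A`: the prefix-minimal words outside `A`. -/
def boundary (A : Finset (List Λ)) : Set (List Λ) :=
  {x | x ∉ A ∧ ∀ y, y <+: x → y ∉ A → y = x}

end Trees

/-- An automaton: each state is mapped to a finitely supported probability distribution on
monomials in `ε` (written `none`) and `a · s` (written `some (a, s)`), that is, to a polynomial
in `ℝ[ε, Λ · S]` with nonnegative coefficients of sum one. -/
structure Automaton (Λ S : Type*) where
  trans : S → MvPolynomial (Option (Λ × S)) ℝ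
  coeff_nonneg : ∀ s m, 0 ≤ (trans s).coeff m
  sum_coeff : ∀ s, ∑ m ∈ (trans s).support, (trans s).coeff m = 1

section Automata

variable {Λ S : Type*} (M : Automaton Λ S)

/-- The structure map `θ`, with `ℝ[ε, Λ · S]` regarded as part of the free word algebra. -/
def theta (s : S) : Free Λ S :=
  MvPolynomial.rename (fun i => i.elim (Sum.inl []) fun z => Sum.inr ([z.1], z.2)) (M.trans s)

/-- The map `f`, with values in the probability measures on multisets of words, is a fixed
point of `f ↦ f^‡ ∘ θ`. -/
def IsSemantics (f : S → ProbabilityMeasure (List Λ → ℕ)) : Prop :=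
  ∀ s, (f s : Measure (List Λ → ℕ)).toSignedMeasure =
    lift (fun t => (f t : Measure (List Λ → ℕ)).toSignedMeasure) (theta M s)

/-- The extension of a semantic map `f` to the finitely supported signed measures on `ℕ^S`,
along `φ_S`. -/
def semExt [Finite S] (f : S → ProbabilityMeasure (List Λ → ℕ)) (μ : FinSupp S) :
    SignedMeasure (List Λ → ℕ) :=
  lift (fun t => (f t : Measure (List Λ → ℕ)).toSignedMeasure) (incl Λ S ((phi S).symm μ))

/-- The endomorphism `x · θ` of the free word algebra. -/
def thetaAt (x : List Λ) : Free Λ S →ₐ[ℝ] Free Λ S :=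
  flatten.comp (partialEval {x} (lift (theta M)))

open scoped Classical in
/-- The extension `θ_A` of the structure map to a finite tree `A`: it is the identity for
`A = ∅`, and `θ_{A ∪ {x}} = (x · θ) ∘ θ_A` for `x ∈ ∂A`. Here the last step is made at a word
of maximal length; see `thetaTree_insert`. -/
def thetaTree (A : Finset (List Λ)) : MvPolynomial S ℝ →ₐ[ℝ] Free Λ S :=
  if h : A.Nonempty then
    (thetaAt M (A.exists_max_image List.length h).choose).comp
      (thetaTree (A.erase (A.exists_max_image List.length h).choose))
  else incl Λ S
termination_by A.card
decreasing_by
  exact Finset.card_erase_lt_of_mem (A.exists_max_image List.length h).choose_spec.1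

/-- `d_A^m(p)`: the coefficient of the monomial `m` in `θ_A(p)`, regarded as a polynomial in the
indeterminates `y · ε` with coefficients in `ℝ[Λ^* · S]`. The exponents of `m` are given by a
finitely supported function on words. -/
def dTree (A : Finset (List Λ)) (m : List Λ →₀ ℕ) (p : MvPolynomial S ℝ) :
    MvPolynomial (List Λ × S) ℝ :=
  (MvPolynomial.sumAlgEquiv ℝ (List Λ) (List Λ × S) (thetaTree M A p)).coeff m

/-- `((∂A ∖ x) · 𝟙)(d_A^m(p))`. -/
def dTreeOne (A : Finset (List Λ)) (x : List Λ) (m : List Λ →₀ ℕ) (p : MvPolynomial S ℝ) :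
    MvPolynomial (List Λ × S) ℝ :=
  partialEval (boundary A \ {x}) (bone Λ S) (MvPolynomial.rename Sum.inr (dTree M A m p))

/-- `d_{A,x}^m(p)`: the polynomial `q ∈ ℝ[S]` with `x · q = ((∂A ∖ x) · 𝟙)(d_A^m(p))`; see
`dAt_spec`. -/
def dAt (A : Finset (List Λ)) (x : List Λ) (m : List Λ →₀ ℕ) (p : MvPolynomial S ℝ) :
    MvPolynomial S ℝ :=
  MvPolynomial.killCompl (Prod.mk_right_injective x) (dTreeOne M A x m p)

theorem thetaTree_empty : thetaTree M ∅ = incl Λ S := by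
  rw [thetaTree]
  simp

theorem thetaAt_eps (x y : List Λ) :
    thetaAt M x (MvPolynomial.X (Sum.inl y)) = MvPolynomial.X (Sum.inl y) := by
  simp [thetaAt, partialEval, flatten, lift, WordAlgebra.act, WordAlgebra.eps]

theorem thetaAt_of_not_prefix {x w : List Λ} (s : S) (h : ¬ x <+: w) :
    thetaAt M x (MvPolynomial.X (Sum.inr (w, s))) = MvPolynomial.X (Sum.inr (w, s)) := by
  simp [thetaAt, partialEval, flatten, h]

theorem thetaAt_of_prefix {x w : List Λ} (s : S) (h : x <+: w) :
    thetaAt M x (MvPolynomial.X (Sum.inr (w, s))) = WordAlgebra.act w (theta M s) := by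
  have H : ∃ y ∈ ({x} : Set (List Λ)), y <+: w := ⟨x, rfl, h⟩
  have hx : H.choose = x := H.choose_spec.1
  obtain ⟨z, rfl⟩ := h
  simp only [thetaAt, partialEval, AlgHom.comp_apply, MvPolynomial.aeval_X, Sum.elim_inr,
    dif_pos H, hx, List.drop_left, lift, flatten, AlgHom.restrictScalars_apply,
    MvPolynomial.aeval_C, WordAlgebra.act_append]
  rfl

theorem hom_congr {σ V : Type*} [CommRing V] [Algebra ℝ V] {I : Set σ}
    {f g : MvPolynomial σ ℝ →ₐ[ℝ] V} (h : ∀ i ∈ I, f (MvPolynomial.X i) = g (MvPolynomial.X i))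
    {p : MvPolynomial σ ℝ} (hp : p ∈ MvPolynomial.supported ℝ I) : f p = g p := by
  have : MvPolynomial.supported ℝ I ≤ AlgHom.equalizer f g :=
    Algebra.adjoin_le (by rintro _ ⟨i, hi, rfl⟩; exact h i hi)
  exact this hp

theorem hom_mem {σ V : Type*} [CommRing V] [Algebra ℝ V] {I : Set σ} {T : Subalgebra ℝ V}
    {f : MvPolynomial σ ℝ →ₐ[ℝ] V} (h : ∀ i ∈ I, f (MvPolynomial.X i) ∈ T)
    {p : MvPolynomial σ ℝ} (hp : p ∈ MvPolynomial.supported ℝ I) : f p ∈ T := by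
  have : MvPolynomial.supported ℝ I ≤ T.comap f :=
    Algebra.adjoin_le (by rintro _ ⟨i, hi, rfl⟩; exact h i hi)
  exact this hp

/-- The polynomial `w · θ(s)` only involves `w · ε` and the `w a · t`. -/
theorem act_theta_mem (w : List Λ) (s : S) :
    WordAlgebra.act w (theta M s) ∈ MvPolynomial.supported ℝ
      ({i | i = Sum.inl w ∨ ∃ a t, i = Sum.inr (w ++ [a], t)} :
        Set (List Λ ⊕ (List Λ × S))) := by
  refine hom_mem (f := (WordAlgebra.act w).comp (MvPolynomial.rename _)) (I := Set.univ) ?_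
    (p := M.trans s) (by rw [MvPolynomial.supported_univ]; trivial)
  rintro (_ | ⟨a, t⟩) -
  · simp only [AlgHom.comp_apply, MvPolynomial.rename_X, WordAlgebra.act, Option.elim,
      Sum.map_inl, List.append_nil]
    exact MvPolynomial.X_mem_supported.2 (Or.inl rfl)
  · simp only [AlgHom.comp_apply, MvPolynomial.rename_X, WordAlgebra.act, Option.elim,
      Sum.map_inr]
    exact MvPolynomial.X_mem_supported.2 (Or.inr ⟨a, t, rfl⟩)

theorem thetaAt_act_theta {x w : List Λ} (s : S) (h : ∀ a, ¬ x <+: w ++ [a]) :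
    thetaAt M x (WordAlgebra.act w (theta M s)) = WordAlgebra.act w (theta M s) := by
  refine hom_congr (g := AlgHom.id ℝ _) ?_ (act_theta_mem M w s)
  rintro _ (rfl | ⟨a, t, rfl⟩)
  · exact thetaAt_eps M x w
  · exact thetaAt_of_not_prefix M t (h a)

theorem thetaAt_comm {x y : List Λ} (hxy : ¬ x <+: y) (hyx : ¬ y <+: x) :
    (thetaAt M x).comp (thetaAt M y) = (thetaAt M y).comp (thetaAt M x) := by
  have key : ∀ {x y : List Λ}, ¬ x <+: y → ¬ y <+: x → ∀ (w : List Λ) (s : S), x <+: w →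
      thetaAt M y (thetaAt M x (MvPolynomial.X (Sum.inr (w, s)))) =
        thetaAt M x (thetaAt M y (MvPolynomial.X (Sum.inr (w, s)))) := by
    intro x y hxy hyx w s hw
    have h : ∀ v, x <+: v → ¬ y <+: v := fun v h₁ h₂ =>
      (List.prefix_or_prefix_of_prefix h₁ h₂).elim hxy hyx
    rw [thetaAt_of_not_prefix M s (h w hw), thetaAt_of_prefix M s hw,
      thetaAt_act_theta M s fun a => h _ (hw.trans (List.prefix_append _ _))]
  refine MvPolynomial.algHom_ext fun i => ?_
  rcases i with w | ⟨w, s⟩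
  · simp only [AlgHom.comp_apply, thetaAt_eps]
  · simp only [AlgHom.comp_apply]
    by_cases h₁ : x <+: w
    · exact (key hxy hyx w s h₁).symm
    · by_cases h₂ : y <+: w
      · exact key hyx hxy w s h₂
      · rw [thetaAt_of_not_prefix M s h₂, thetaAt_of_not_prefix M s h₁,
          thetaAt_of_not_prefix M s h₂]

theorem isTree_erase [DecidableEq (List Λ)] {A : Finset (List Λ)} (hA : IsTree A) {x : List Λ}
    (hx : ∀ y ∈ A, y.length ≤ x.length) : IsTree (A.erase x) := by
  intro y hy z hz
  rw [Finset.mem_erase] at hy ⊢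
  refine ⟨?_, hA y hy.2 z hz⟩
  rintro rfl
  exact hy.1 (hz.eq_of_length_le (hx y hy.2)).symm

theorem mem_boundary_erase [DecidableEq (List Λ)] {A : Finset (List Λ)} (hA : IsTree A)
    {x : List Λ} (hx : x ∈ A) : x ∈ boundary (A.erase x) := by
  refine ⟨by simp, fun y hy hyA => ?_⟩
  by_contra h
  exact hyA (Finset.mem_erase.2 ⟨h, hA x hx y hy⟩)

theorem isTree_insert [DecidableEq (List Λ)] {A : Finset (List Λ)} (hA : IsTree A)
    {x : List Λ} (hx : x ∈ boundary A) : IsTree (insert x A) := by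
  intro y hy z hz
  rw [Finset.mem_insert] at hy ⊢
  rcases hy with rfl | hy
  · by_cases h : z ∈ A
    · exact Or.inr h
    · exact Or.inl (hx.2 z hz h)
  · exact Or.inr (hA y hy z hz)

theorem thetaTree_eq [DecidableEq (List Λ)] {A : Finset (List Λ)} (h : A.Nonempty) :
    ∃ x ∈ A, (∀ y ∈ A, y.length ≤ x.length) ∧
      thetaTree M A = (thetaAt M x).comp (thetaTree M (A.erase x)) := by
  refine ⟨_, (A.exists_max_image List.length h).choose_spec.1,
    (A.exists_max_image List.length h).choose_spec.2, ?_⟩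
  rw [thetaTree, dif_pos h]
  congr!

/-- The order in which a tree is built does not matter. -/
theorem thetaTree_insert [DecidableEq (List Λ)] (A : Finset (List Λ)) (hA : IsTree A)
    (x : List Λ) (hx : x ∈ boundary A) :
    thetaTree M (insert x A) = (thetaAt M x).comp (thetaTree M A) := by
  induction hn : A.card using Nat.strong_induction_on generalizing A x with
  | _ n ih =>
    obtain ⟨z, hz, hmax, h⟩ := thetaTree_eq M (Finset.insert_nonempty x A)
    rw [h]
    by_cases hzx : z = x
    · subst hzx
      rw [Finset.erase_insert hx.1]
    · have hzA : z ∈ A := (Finset.mem_insert.1 hz).resolve_left hzx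
      have hmaxA : ∀ y ∈ A, y.length ≤ z.length := fun y hy =>
        hmax y (Finset.mem_insert_of_mem hy)
      have hA' := isTree_erase hA hmaxA
      have hzx' : ¬ z <+: x := fun hp =>
        hzx (hp.eq_of_length_le (hmax x (Finset.mem_insert_self x A)))
      have hxz' : ¬ x <+: z := fun hp => hx.1 (hA z hzA x hp)
      have hx' : x ∈ boundary (A.erase z) := by
        refine ⟨fun h => hx.1 (Finset.mem_of_mem_erase h), fun y hy hyA => ?_⟩
        refine hx.2 y hy fun h => hyA (Finset.mem_erase.2 ⟨?_, h⟩)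
        rintro rfl
        exact hzx' hy
      have hcard : (A.erase z).card < n := hn ▸ Finset.card_erase_lt_of_mem hzA
      rw [Finset.erase_insert_of_ne (Ne.symm hzx), ih _ hcard _ hA' x hx' rfl, ← AlgHom.comp_assoc,
        thetaAt_comm M hzx' hxz', AlgHom.comp_assoc,
        ← ih _ hcard _ hA' z (mem_boundary_erase hA hzA) rfl, Finset.insert_erase hzA]

/-- The invariant `θ_A(p) ∈ ℝ[A · ε, ∂A · S]`. -/
theorem thetaTree_mem (A : Finset (List Λ)) (hA : IsTree A) (p : MvPolynomial S ℝ) :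
    thetaTree M A p ∈ MvPolynomial.supported ℝ
      ({i | (∃ y ∈ A, i = Sum.inl y) ∨ ∃ y ∈ boundary A, ∃ t, i = Sum.inr (y, t)} :
        Set (List Λ ⊕ (List Λ × S))) := by
  classical
  induction hn : A.card using Nat.strong_induction_on generalizing A with
  | _ n ih =>
    rcases A.eq_empty_or_nonempty with rfl | hne
    · rw [thetaTree_empty]
      refine hom_mem (I := Set.univ) ?_ (by rw [MvPolynomial.supported_univ]; trivial)
      intro s _
      rw [incl, MvPolynomial.rename_X]
      exact MvPolynomial.X_mem_supported.2
        (Or.inr ⟨[], ⟨by simp, fun y hy _ => List.prefix_nil.1 hy⟩, s, rfl⟩)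
    · obtain ⟨x, hx, hmax, h⟩ := thetaTree_eq M hne
      have hcard : (A.erase x).card < n := hn ▸ Finset.card_erase_lt_of_mem hx
      rw [h, AlgHom.comp_apply]
      refine hom_mem ?_ (ih _ hcard _ (isTree_erase hA hmax) rfl)
      rintro _ (⟨y, hy, rfl⟩ | ⟨y, hy, t, rfl⟩)
      · rw [thetaAt_eps]
        exact MvPolynomial.X_mem_supported.2 (Or.inl ⟨y, Finset.mem_of_mem_erase hy, rfl⟩)
      · by_cases hxy : x <+: y
        · obtain rfl : x = y := hy.2 x hxy (by simp)
          rw [thetaAt_of_prefix M t hxy]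
          refine MvPolynomial.supported_mono ?_ (act_theta_mem M x t)
          rintro _ (rfl | ⟨a, t, rfl⟩)
          · exact Or.inl ⟨x, hx, rfl⟩
          · refine Or.inr ⟨x ++ [a], ⟨fun hmem => ?_, fun z hz hzA => ?_⟩, t, rfl⟩
            · have := hmax _ hmem
              simp at this
            · rcases List.prefix_concat_iff.1 hz with h | h
              · exact h
              · exact absurd (hA x hx z h) hzA
        · rw [thetaAt_of_not_prefix M t hxy]
          refine MvPolynomial.X_mem_supported.2 (Or.inr ⟨y, ⟨fun hyA => hy.1 ?_, ?_⟩, t, rfl⟩)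
          · exact Finset.mem_erase.2 ⟨fun h => hxy (h ▸ List.prefix_refl _), hyA⟩
          · exact fun z hz hzA => hy.2 z hz fun h => hzA (Finset.mem_of_mem_erase h)

/-- The defining equation of `d_{A,x}^m(p)`. -/
theorem dAt_spec (A : Finset (List Λ)) (hA : IsTree A) (x : List Λ)
    (m : List Λ →₀ ℕ) (p : MvPolynomial S ℝ) :
    MvPolynomial.rename (fun s => (x, s)) (dAt M A x m p) = dTreeOne M A x m p := by
  have h₁ : ∀ q ∈ MvPolynomial.supported ℝ
      ({i | (∃ y ∈ A, i = Sum.inl y) ∨ ∃ y ∈ boundary A, ∃ t, i = Sum.inr (y, t)} :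
        Set (List Λ ⊕ (List Λ × S))), ∀ m : List Λ →₀ ℕ,
      (MvPolynomial.sumAlgEquiv ℝ (List Λ) (List Λ × S) q).coeff m ∈
        MvPolynomial.supported ℝ {i : List Λ × S | i.1 ∈ boundary A} := by
    classical
    let U := MvPolynomial.supported ℝ {i : List Λ × S | i.1 ∈ boundary A}
    let T : Subalgebra ℝ (MvPolynomial (List Λ) (MvPolynomial (List Λ × S) ℝ)) :=
      { carrier := {q | ∀ m, q.coeff m ∈ U}
        mul_mem' := fun {f g} hf hg m => by
          rw [MvPolynomial.coeff_mul]
          exact sum_mem fun z _ => mul_mem (hf _) (hg _)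
        add_mem' := fun {f g} hf hg m => by
          rw [MvPolynomial.coeff_add]
          exact add_mem (hf _) (hg _)
        algebraMap_mem' := fun r m => by
          rw [MvPolynomial.algebraMap_apply, MvPolynomial.coeff_C]
          split_ifs
          · exact U.algebraMap_mem r
          · exact zero_mem U }
    intro q hq
    refine hom_mem (f := (MvPolynomial.sumAlgEquiv ℝ (List Λ) (List Λ × S)).toAlgHom) (T := T)
      ?_ hq
    rintro _ (⟨y, hy, rfl⟩ | ⟨y, hy, t, rfl⟩) m
    · change (MvPolynomial.sumAlgEquiv ℝ (List Λ) (List Λ × S)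
        (MvPolynomial.X (Sum.inl y))).coeff m ∈ U
      rw [MvPolynomial.sumAlgEquiv_X_inl, MvPolynomial.coeff_X]
      split_ifs
      · exact one_mem U
      · exact zero_mem U
    · change (MvPolynomial.sumAlgEquiv ℝ (List Λ) (List Λ × S)
        (MvPolynomial.X (Sum.inr (y, t)))).coeff m ∈ U
      rw [MvPolynomial.sumAlgEquiv_X_inr, MvPolynomial.coeff_C]
      split_ifs
      · exact MvPolynomial.X_mem_supported.2 hy
      · exact zero_mem U
  have h₂ : dTreeOne M A x m p ∈
      (MvPolynomial.rename (R := ℝ) fun s : S => (x, s)).range := by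
    refine hom_mem (f := (partialEval (boundary A \ {x}) (bone Λ S)).comp
      (MvPolynomial.rename Sum.inr)) ?_ (h₁ _ (thetaTree_mem M A hA p) m)
    rintro ⟨y, s⟩ hy
    simp only [AlgHom.comp_apply, MvPolynomial.rename_X, partialEval, MvPolynomial.aeval_X,
      Sum.elim_inr]
    split_ifs with H
    · exact Subalgebra.algebraMap_mem _ _
    · obtain rfl : y = x := by
        by_contra hne
        exact H ⟨y, ⟨hy, hne⟩, List.prefix_refl _⟩
      exact ⟨MvPolynomial.X s, MvPolynomial.rename_X _ _⟩
  obtain ⟨q, hq⟩ := h₂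
  rw [dAt, ← hq]
  exact congrArg _ (MvPolynomial.killCompl_rename_app _ q)

end Automata
end
end PKA

/-! Everything rests on truncation: restricting a multiset to a set of words is additive, so the
induced pushforward of signed measures is an algebra homomorphism (`truncHom`). Every cylinder
involves finitely many words, hence words of bounded length, so a signed measure is determined by
its truncations to the balls of words of length less than `n` (`eq_of_truncHom_ball`).

Existence and uniqueness are a contraction argument. In `θ(s)` each state stands behind one letter,
so the truncation of `f^‡(θ(s))` to length less than `n + 1` depends only on the truncation of `f`
to length less than `n` (`truncHom_lift_theta_congr`). At level `0` all probability measures agree,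
which gives uniqueness by induction. It also makes the iterates of `f ↦ f^‡ ∘ θ` stabilise at every
level; a limit with the prescribed truncations exists by an Ionescu-Tulcea construction
(`exists_limit`), and it is a fixed point.

For the criterion, the fixed point equation says that applying `x · θ` does not change the
semantics, so the semantics of `p` is that of `θ_A(p)`. Truncate it to `A`. For `y ∈ A`, `y · ε`
stays the point mass at `{y}`. For `x ∈ ∂A`, the measure of `x · s` lives on multisets of extensions
of `x`, none of which is in `A`, so it becomes the unit. The truncation is therefore `θ_A(p)` with
all states replaced by `1`, read as a signed measure (`IsSemantics.truncHom_lift_incl`). Distinct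
polynomials give distinct measures, so it vanishes exactly when all its coefficients do, and the
coefficient at `m` is the value of `𝟙` on `d_{A,x}^m(p)`, whichever `x ∈ ∂A` is chosen (`bone_dAt`).
Balls are finite trees, so these truncations detect whether the semantics of `p` is zero. -/

open MeasureTheory

namespace PKA

noncomputable section

/-! ### Probability measures inside the algebra of signed measures -/

section ProbabilityMeasures

variable {X Y : Type*} [MeasurableSpace X] [MeasurableSpace Y]

/-- A signed measure that comes from a probability measure. -/
def IsProb (μ : SignedMeasure X) : Prop :=
  ∃ P : ProbabilityMeasure X, (P : Measure X).toSignedMeasure = μ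

theorem toSignedMeasure_map (P : Measure X) [IsFiniteMeasure P] {f : X → Y} (hf : Measurable f) :
    P.toSignedMeasure.map f = (P.map f).toSignedMeasure := by
  ext s hs
  rw [VectorMeasure.map_apply _ hf hs, Measure.toSignedMeasure_apply_measurable hs,
    Measure.toSignedMeasure_apply_measurable (hf hs), map_measureReal_apply hf hs]

theorem tensor_toSignedMeasure (P : Measure X) [IsFiniteMeasure P] (Q : Measure Y)
    [IsFiniteMeasure Q] :
    tensor P.toSignedMeasure Q.toSignedMeasure = (P.prod Q).toSignedMeasure :=
  tensor_eq fun s t hs ht => by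
    rw [Measure.toSignedMeasure_apply_measurable (hs.prod ht),
      Measure.toSignedMeasure_apply_measurable hs, Measure.toSignedMeasure_apply_measurable ht,
      measureReal_prod_prod]

theorem IsProb.map {μ : SignedMeasure X} (h : IsProb μ) {f : X → Y} (hf : Measurable f) :
    IsProb (μ.map f) := by
  obtain ⟨P, rfl⟩ := h
  exact ⟨P.map hf.aemeasurable, (toSignedMeasure_map _ hf).symm⟩

theorem isProb_dirac (x : X) : IsProb (VectorMeasure.dirac x 1 : SignedMeasure X) := by
  refine ⟨⟨Measure.dirac x, inferInstance⟩, ?_⟩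
  ext s hs
  change (Measure.dirac x).toSignedMeasure s = _
  rw [Measure.toSignedMeasure_apply_measurable hs, measureReal_def, Measure.dirac_apply' _ hs]
  by_cases h : x ∈ s
  · rw [VectorMeasure.dirac_apply_of_mem hs h]; simp [h]
  · rw [VectorMeasure.dirac_apply_of_notMem h]; simp [h]

theorem IsProb.univ {μ : SignedMeasure X} (h : IsProb μ) : μ Set.univ = 1 := by
  obtain ⟨P, rfl⟩ := h
  simp

theorem IsProb.nonneg {μ : SignedMeasure X} (h : IsProb μ) (s : Set X) : 0 ≤ μ s := by
  obtain ⟨P, rfl⟩ := h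
  rw [Measure.toSignedMeasure_apply]
  split_ifs <;> positivity

/-- Convex combinations are formed among signed measures; this is the way back to genuine measures.
-/
theorem isProb_of_nonneg {μ : SignedMeasure X} (h : ∀ s, MeasurableSet s → 0 ≤ μ s)
    (h₁ : μ Set.univ = 1) : IsProb μ := by
  have h0 : 0 ≤[Set.univ] μ := by
    rw [VectorMeasure.le_restrict_univ_iff_le, VectorMeasure.le_iff]
    exact h
  have hμ := SignedMeasure.toMeasureOfZeroLE_toSignedMeasure μ h0
  set P := μ.toMeasureOfZeroLE Set.univ MeasurableSet.univ h0
  refine ⟨⟨P, ⟨?_⟩⟩, hμ⟩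
  have : P.real Set.univ = 1 := by
    rw [← Measure.toSignedMeasure_apply_measurable MeasurableSet.univ, hμ, h₁]
  rw [measureReal_def] at this
  rwa [← ENNReal.toReal_eq_one_iff]

theorem isProb_sum {ι : Type*} (F : Finset ι) (c : ι → ℝ) (μ : ι → SignedMeasure X)
    (hc : ∀ i, 0 ≤ c i) (hc₁ : ∑ i ∈ F, c i = 1) (hμ : ∀ i ∈ F, IsProb (μ i)) :
    IsProb (∑ i ∈ F, c i • μ i) := by
  have key : ∀ s, (∑ i ∈ F, c i • μ i) s = ∑ i ∈ F, c i * μ i s := fun s => by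
    simp
  refine isProb_of_nonneg (fun s _ => ?_) ?_
  · rw [key]
    exact Finset.sum_nonneg fun i hi => mul_nonneg (hc i) ((hμ i hi).nonneg s)
  · rw [key, ← hc₁]
    exact Finset.sum_congr rfl fun i hi => by rw [(hμ i hi).univ, mul_one]

variable [AddCommMonoid X] [MeasurableAdd₂ X]

theorem isProb_one : IsProb (1 : SignedMeasure X) := isProb_dirac 0

theorem IsProb.mul {μ ν : SignedMeasure X} (hμ : IsProb μ) (hν : IsProb ν) :
    IsProb (μ * ν) := by
  obtain ⟨P, rfl⟩ := hμ
  obtain ⟨Q, rfl⟩ := hν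
  change IsProb ((tensor _ _).map _)
  rw [tensor_toSignedMeasure]
  exact IsProb.map ⟨P.prod Q, rfl⟩ measurable_sum_pair

theorem IsProb.pow {μ : SignedMeasure X} (hμ : IsProb μ) (k : ℕ) : IsProb (μ ^ k) := by
  induction k with
  | zero => rw [pow_zero]; exact isProb_one
  | succ k ih => rw [pow_succ]; exact ih.mul hμ

/-- A convex combination of monomials evaluated at probability measures is a probability
measure. -/
theorem isProb_aeval {σ : Type*} (p : MvPolynomial σ ℝ) (hp : ∀ m, 0 ≤ p.coeff m)
    (hp₁ : ∑ m ∈ p.support, p.coeff m = 1) (f : σ → SignedMeasure X) (hf : ∀ i, IsProb (f i)) :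
    IsProb (MvPolynomial.aeval f p) := by
  rw [MvPolynomial.aeval_def, MvPolynomial.eval₂_eq]
  simp only [← Algebra.smul_def]
  refine isProb_sum _ _ _ hp hp₁ fun m _ => ?_
  exact Finset.prod_induction _ IsProb (fun _ _ => IsProb.mul) isProb_one
    fun i _ => (hf i).pow _

end ProbabilityMeasures

/-! ### Extension of consistent laws to infinite sequences -/

section Trajectories

open ProbabilityTheory Preorder

/-- Consistent laws of finite initial segments extend to the law of an infinite sequence. -/
theorem exists_law_of_consistent {Ω Y : Type*} [MeasurableSpace Ω] [MeasurableSpace Y]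
    [StandardBorelSpace Y] [Nonempty Y] (P : ℕ → Measure Ω) [∀ n, IsProbabilityMeasure (P n)]
    (g : ℕ → Ω → Y) (hg : ∀ n, Measurable (g n))
    (h : ∀ n, (P (n + 1)).map (fun ω (i : Finset.Iic n) => g i.1 ω) =
      (P n).map fun ω (i : Finset.Iic n) => g i.1 ω) :
    ∃ Q : Measure (ℕ → Y), IsProbabilityMeasure Q ∧
      ∀ n, Q.map (frestrictLe n) = (P n).map fun ω (i : Finset.Iic n) => g i.1 ω := by
  have hV : ∀ n, Measurable fun ω (i : Finset.Iic n) => g i.1 ω := fun n =>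
    by fun_prop
  -- The transition kernel is the conditional law of the next value given the past, taken under `P
  -- (n + 1)`; the Ionescu-Tulcea theorem turns these kernels into `Q`.
  let κ : (n : ℕ) → Kernel (Finset.Iic n → Y) Y := fun n =>
    condDistrib (g (n + 1)) (fun ω (i : Finset.Iic n) => g i.1 ω) (P (n + 1))
  let μ₀ : Measure Y := (P 0).map (g 0)
  have : IsProbabilityMeasure μ₀ := Measure.isProbabilityMeasure_map (hg 0).aemeasurable
  let Q : Measure (ℕ → Y) := Kernel.trajMeasure (X := fun _ => Y) μ₀ κ
  refine ⟨Q, inferInstance, fun n => ?_⟩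
  induction n with
  | zero =>
    change ((Kernel.traj (X := fun _ => Y) κ 0) ∘ₘ _).map _ = _
    rw [Measure.map_comp _ _ (by fun_prop), Kernel.traj_map_frestrictLe, Kernel.partialTraj_self,
      Measure.id_comp, Measure.map_map (MeasurableEquiv.measurable _) (hg 0)]
    congr 1
    ext ω ⟨i, hi⟩
    obtain rfl : i = 0 := by simpa using hi
    rfl
  | succ n ih =>
    have h₁ : Q.map (frestrictLe n) ⊗ₘ κ n = Q.map fun x => (frestrictLe n x, x (n + 1)) :=
      Kernel.map_frestrictLe_trajMeasure_compProd_eq_map_trajMeasure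
    -- Consistency replaces the law of the past under `P n` by its law under `P (n + 1)`, the
    -- measure from which `κ n` was disintegrated, so the composite is the joint law of past and
    -- next value.
    rw [ih, ← h, compProd_map_condDistrib (hg _).aemeasurable] at h₁
    -- `G` appends the next value to the initial segment.
    let G : (Finset.Iic n → Y) × Y → Finset.Iic (n + 1) → Y := fun z i =>
      if hi : i.1 ≤ n then z.1 ⟨i, Finset.mem_Iic.2 hi⟩ else z.2
    have hG : Measurable G := by
      refine measurable_pi_lambda _ fun i => ?_
      by_cases hi : i.1 ≤ n
      · simp only [G, hi, dite_true]; fun_prop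
      · simp only [G, hi, dite_false]; fun_prop
    have h₂ := congrArg (Measure.map G) h₁
    rw [Measure.map_map hG ((hV n).prodMk (hg _)), Measure.map_map hG (by fun_prop)] at h₂
    have key : ∀ x : ℕ → Y, G (frestrictLe n x, x (n + 1)) = frestrictLe (n + 1) x := by
      intro x
      ext ⟨i, hi⟩
      by_cases hn : i ≤ n
      · simp [G, hn]
      · obtain rfl : i = n + 1 := by
          have := Finset.mem_Iic.1 hi
          omega
        simp [G]
    refine Eq.trans (congrArg (Measure.map · Q) ?_) (h₂.symm.trans (congrArg (Measure.map · _) ?_))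
    · ext1 x; exact (key x).symm
    · ext1 ω; exact key fun i => g i ω

end Trajectories

/-! ### Restriction of multisets to a set of words -/

section Truncation

variable {Λ : Type*}

/-- The restriction of a multiset of words to a set of words. -/
def trunc (A : Set (List Λ)) : (List Λ → ℕ) →+ (List Λ → ℕ) where
  toFun α := A.indicator α
  map_zero' := Set.indicator_zero _ _
  map_add' α β := Set.indicator_add _ α β

theorem trunc_apply (A : Set (List Λ)) (α : List Λ → ℕ) : trunc A α = A.indicator α := rfl

theorem measurable_trunc (A : Set (List Λ)) : Measurable (trunc A) := by
  refine measurable_pi_lambda _ fun w => ?_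
  by_cases h : w ∈ A
  · simp only [trunc_apply, Set.indicator_of_mem h]; fun_prop
  · simp only [trunc_apply, Set.indicator_of_notMem h]; fun_prop

/-- The pushforward of signed measures under restriction to a set of words. -/
def truncHom (A : Set (List Λ)) :
    SignedMeasure (List Λ → ℕ) →ₐ[ℝ] SignedMeasure (List Λ → ℕ) :=
  pushforward (trunc A) (measurable_trunc A)

/-- The words of length less than `n`. -/
def ball (Λ : Type*) (n : ℕ) : Set (List Λ) := {w | w.length < n}

/-- A signed measure is determined by its restrictions to words of bounded length. -/
theorem eq_of_truncHom_ball {μ ν : SignedMeasure (List Λ → ℕ)}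
    (h : ∀ n, truncHom (ball Λ n) μ = truncHom (ball Λ n) ν) : μ = ν := by
  have key : ∀ (n : ℕ) (s : Set (List Λ → ℕ)), MeasurableSet s → trunc (ball Λ n) ⁻¹' s = s →
      μ s = ν s := by
    intro n s hs hsn
    have := congrArg (fun ρ : SignedMeasure (List Λ → ℕ) => ρ s) (h n)
    simp only [truncHom, pushforward_apply, VectorMeasure.map_apply _ (measurable_trunc _) hs]
      at this
    rwa [hsn] at this
  refine VectorMeasure.ext_of_generateFrom (measurableCylinders fun _ : List Λ => ℕ) ?_
    generateFrom_measurableCylinders.symm isPiSystem_measurableCylinders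
    (key 0 _ MeasurableSet.univ rfl)
  intro s hs
  obtain ⟨I, t, ht, rfl⟩ := (mem_measurableCylinders _).1 hs
  -- The radius is one more than the greatest length in `I`, because the ball is defined by a strict
  -- inequality. Truncation to it leaves the coordinates in `I` unchanged.
  refine key (I.sup List.length + 1) _ (MeasurableSet.of_mem_measurableCylinders hs) ?_
  ext α
  simp only [Set.mem_preimage, mem_cylinder]
  have : I.restrict (trunc (ball Λ (I.sup List.length + 1)) α) = I.restrict α := by
    ext ⟨w, hw⟩
    have hw' : w ∈ ball Λ (I.sup List.length + 1) :=
      Nat.lt_succ_of_le (Finset.le_sup (f := List.length) hw)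
    exact Set.indicator_of_mem hw' α
  rw [this]

theorem map_eq_dirac_of_const {X Y : Type*} [MeasurableSpace X] [MeasurableSpace Y]
    {μ : SignedMeasure X} (hμ : IsProb μ) {f : X → Y} (hf : Measurable f) (y : Y)
    (h : ∀ x, f x = y) : μ.map f = VectorMeasure.dirac y 1 := by
  ext s hs
  rw [VectorMeasure.map_apply _ hf hs]
  by_cases hy : y ∈ s
  · have : f ⁻¹' s = Set.univ := by ext x; simp [h, hy]
    rw [this, hμ.univ, VectorMeasure.dirac_apply_of_mem hs hy]
  · have : f ⁻¹' s = ∅ := by ext x; simp [h, hy]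
    rw [this, VectorMeasure.empty, VectorMeasure.dirac_apply_of_notMem hy]

theorem trunc_ball_shift_cons (n : ℕ) (a : Λ) (α : List Λ → ℕ) :
    trunc (ball Λ (n + 1)) (shift [a] α) = shift [a] (trunc (ball Λ n) α) := by
  classical
  ext w
  change (ball Λ (n + 1)).indicator (fun y => if [a] <+: y then α (y.drop 1) else 0) w =
    if [a] <+: w then (ball Λ n).indicator α (w.drop 1) else 0
  rcases w with _ | ⟨b, w⟩
  · simp
  · simp only [Set.indicator, ball, List.cons_prefix_cons, List.nil_prefix, and_true,
      List.drop_succ_cons, List.drop_zero, Set.mem_ofPred_eq, List.length_cons,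
      Nat.add_lt_add_iff_right]
    split_ifs <;> rfl

/-- Prefixing a letter lengthens every word by one. This shift of level is the source of the
contraction. -/
theorem truncHom_ball_act_cons (n : ℕ) (a : Λ) (μ : SignedMeasure (List Λ → ℕ)) :
    truncHom (ball Λ (n + 1)) (WordAlgebra.act [a] μ) =
      WordAlgebra.act [a] (truncHom (ball Λ n) μ) := by
  change (μ.map (shift [a])).map (trunc _) = (μ.map (trunc _)).map (shift [a])
  rw [map_map _ (measurable_shift _) (measurable_trunc _),
    map_map _ (measurable_trunc _) (measurable_shift _)]
  congr 1
  ext1 α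
  exact trunc_ball_shift_cons n a α

/-- No word has negative length, so only the total mass survives. This starts the inductions on the
level. -/
theorem truncHom_ball_zero {μ : SignedMeasure (List Λ → ℕ)} (h : IsProb μ) :
    truncHom (ball Λ 0) μ = 1 :=
  map_eq_dirac_of_const h (measurable_trunc _) 0 fun α => by
    ext w; simp [trunc_apply, ball]

theorem trunc_ball_of_le {m n : ℕ} (h : m ≤ n) (α : List Λ → ℕ) :
    trunc (ball Λ m) (trunc (ball Λ n) α) = trunc (ball Λ m) α := by
  have hmn : ball Λ m ⊆ ball Λ n := fun w (hw : w.length < m) => hw.trans_le h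
  rw [trunc_apply, trunc_apply, trunc_apply, Set.indicator_indicator, Set.inter_eq_left.2 hmn]

/-- A sequence of probability measures whose restrictions to words of bounded length become
constant has a limit. -/
theorem exists_limit [Countable Λ] (P : ℕ → ProbabilityMeasure (List Λ → ℕ))
    (h : ∀ n, truncHom (ball Λ n) (P (n + 1) : Measure (List Λ → ℕ)).toSignedMeasure =
      truncHom (ball Λ n) (P n : Measure (List Λ → ℕ)).toSignedMeasure) :
    ∃ Q : ProbabilityMeasure (List Λ → ℕ), ∀ n,
      truncHom (ball Λ n) (Q : Measure (List Λ → ℕ)).toSignedMeasure =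
        truncHom (ball Λ n) (P n : Measure (List Λ → ℕ)).toSignedMeasure := by
  have h' : ∀ n, (P (n + 1) : Measure (List Λ → ℕ)).map (trunc (ball Λ n)) =
      (P n : Measure (List Λ → ℕ)).map (trunc (ball Λ n)) := fun n => by
    have := h n
    simp only [truncHom, pushforward_apply] at this
    rwa [toSignedMeasure_map _ (measurable_trunc _), toSignedMeasure_map _ (measurable_trunc _),
      Measure.toSignedMeasure_eq_toSignedMeasure_iff] at this
  have hV : ∀ n, Measurable fun (α : List Λ → ℕ) (i : Finset.Iic n) => trunc (ball Λ i.1) α :=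
    fun n => measurable_pi_lambda _ fun i => measurable_trunc (ball Λ i.1)
  -- The random sequence is that of all truncations of one multiset; countability of `Λ` makes its
  -- state space standard Borel, as conditional laws require.
  obtain ⟨Q, hQ, hQP⟩ := exists_law_of_consistent
    (fun n => (P n : Measure (List Λ → ℕ))) (fun n => trunc (ball Λ n))
    (fun n => measurable_trunc _) fun n => by
      -- The truncations of level at most `n` factor through the one of level `n`, on which `P (n +
      -- 1)` and `P n` agree.
      have := congrArg (Measure.map fun (α : List Λ → ℕ) (i : Finset.Iic n) =>
        trunc (ball Λ i.1) α) (h' n)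
      rw [Measure.map_map (hV n) (measurable_trunc _), Measure.map_map (hV n) (measurable_trunc _)]
        at this
      convert this using 2 <;>
      · ext1 α
        ext1 i
        exact (trunc_ball_of_le (Finset.mem_Iic.1 i.2) α).symm
  -- A diagonal reading: `w.length + 1` is the first level whose ball contains `w`.
  let D : (ℕ → List Λ → ℕ) → List Λ → ℕ := fun ω w => ω (w.length + 1) w
  have hD : Measurable D := by fun_prop
  refine ⟨⟨Q.map D, Measure.isProbabilityMeasure_map hD.aemeasurable⟩, fun n => ?_⟩
  simp only [truncHom, pushforward_apply, ProbabilityMeasure.coe_mk]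
  rw [toSignedMeasure_map _ (measurable_trunc _), toSignedMeasure_map _ (measurable_trunc _),
    Measure.toSignedMeasure_eq_toSignedMeasure_iff, Measure.map_map (measurable_trunc _) hD]
  -- The truncation of `D ω` to level `n` uses only entries of index at most `n`; `G` is that
  -- dependence. On the truncations of a single multiset it returns the one of level `n`.
  let G : (Finset.Iic n → List Λ → ℕ) → List Λ → ℕ := fun ω w =>
    if hw : w.length + 1 ≤ n then ω ⟨w.length + 1, Finset.mem_Iic.2 hw⟩ w else 0
  have hG : Measurable G := by
    refine measurable_pi_lambda _ fun w => ?_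
    by_cases hw : w.length + 1 ≤ n
    · simp only [G, hw, dite_true]; fun_prop
    · simp only [G, hw, dite_false]; fun_prop
  have h₂ := congrArg (Measure.map G) (hQP n)
  rw [Measure.map_map hG (by fun_prop), Measure.map_map hG (hV n)] at h₂
  refine Eq.trans (congrArg (Measure.map · _) ?_) (h₂.trans (congrArg (Measure.map · _) ?_))
  · ext ω w
    by_cases hw : w.length < n
    · simp [trunc_apply, ball, G, D, hw]
    · simp [trunc_apply, ball, G, hw]
  · ext ω w
    by_cases hw : w.length < n
    · simp [trunc_apply, ball, G, hw]
    · simp [trunc_apply, ball, G, hw]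

end Truncation

/-! ### Existence and uniqueness of the semantics -/

section Existence

variable {Λ S : Type*} (M : Automaton Λ S)

/-- This leads back from the free algebra to `M.trans s`, where the coefficient conditions are
stated and only `ε` and one-letter shifts of states occur. -/
theorem lift_theta {V : Type*} [CommRing V] [Algebra ℝ V] [WordAlgebra Λ V] (f : S → V) (s : S) :
    lift f (theta M s) = MvPolynomial.aeval
      (fun i : Option (Λ × S) => i.elim (WordAlgebra.eps Λ) fun z => WordAlgebra.act [z.1] (f z.2))
      (M.trans s) := by
  rw [lift, theta, MvPolynomial.aeval_rename]
  congr 2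
  ext1 i
  rcases i with _ | z
  · simp [WordAlgebra.act_nil]
  · rfl

/-- One unfolding of the automaton determines one more level of words. -/
theorem truncHom_lift_theta_congr {n : ℕ} {f g : S → SignedMeasure (List Λ → ℕ)}
    (h : ∀ t, truncHom (ball Λ n) (f t) = truncHom (ball Λ n) (g t)) (s : S) :
    truncHom (ball Λ (n + 1)) (lift f (theta M s)) =
      truncHom (ball Λ (n + 1)) (lift g (theta M s)) := by
  rw [lift_theta, lift_theta]
  simp only [← AlgHom.comp_apply]
  congr 1
  refine MvPolynomial.algHom_ext fun i => ?_
  rcases i with _ | ⟨a, t⟩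
  · simp
  · simp [truncHom_ball_act_cons, h]

theorem isProb_lift_theta {f : S → SignedMeasure (List Λ → ℕ)} (hf : ∀ s, IsProb (f s)) (s : S) :
    IsProb (lift f (theta M s)) := by
  rw [lift_theta]
  refine isProb_aeval _ (M.coeff_nonneg s) (M.sum_coeff s) _ fun i => ?_
  rcases i with _ | z
  · exact isProb_dirac _
  · exact (hf z.2).map (measurable_shift _)

theorem IsSemantics.unique {f g : S → ProbabilityMeasure (List Λ → ℕ)} (hf : IsSemantics M f)
    (hg : IsSemantics M g) : f = g := by
  have key : ∀ n s, truncHom (ball Λ n) (f s : Measure (List Λ → ℕ)).toSignedMeasure =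
      truncHom (ball Λ n) (g s : Measure (List Λ → ℕ)).toSignedMeasure := by
    intro n
    induction n with
    | zero =>
      intro s
      rw [truncHom_ball_zero ⟨f s, rfl⟩, truncHom_ball_zero ⟨g s, rfl⟩]
    | succ n ih =>
      intro s
      rw [hf s, hg s]
      exact truncHom_lift_theta_congr M ih s
  ext1 s
  refine Subtype.ext ?_
  exact (Measure.toSignedMeasure_eq_toSignedMeasure_iff (μ := (f s : Measure (List Λ → ℕ)))
    (ν := (g s : Measure (List Λ → ℕ)))).1 (eq_of_truncHom_ball fun n => key n s)

/-- One unfolding of the automaton, as a map on families of probability measures. -/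
def unfoldSem (f : S → ProbabilityMeasure (List Λ → ℕ)) (s : S) :
    ProbabilityMeasure (List Λ → ℕ) :=
  (isProb_lift_theta M (f := fun t => (f t : Measure (List Λ → ℕ)).toSignedMeasure)
    (fun t => ⟨f t, rfl⟩) s).choose

theorem toSignedMeasure_unfoldSem (f : S → ProbabilityMeasure (List Λ → ℕ)) (s : S) :
    (unfoldSem M f s : Measure (List Λ → ℕ)).toSignedMeasure =
      lift (fun t => (f t : Measure (List Λ → ℕ)).toSignedMeasure) (theta M s) :=
  (isProb_lift_theta M (f := fun t => (f t : Measure (List Λ → ℕ)).toSignedMeasure)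
    (fun t => ⟨f t, rfl⟩) s).choose_spec

theorem exists_isSemantics [Countable Λ] :
    ∃ f : S → ProbabilityMeasure (List Λ → ℕ), IsSemantics M f := by
  -- The starting family is arbitrary, since all probability measures agree at level `0`.
  let F : ℕ → S → ProbabilityMeasure (List Λ → ℕ) := fun n =>
    (unfoldSem M)^[n] fun _ => ⟨Measure.dirac 0, inferInstance⟩
  have hF : ∀ n, F (n + 1) = unfoldSem M (F n) := fun n => Function.iterate_succ_apply' _ _ _
  have hstep : ∀ n s, truncHom (ball Λ n) (F (n + 1) s : Measure (List Λ → ℕ)).toSignedMeasure =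
      truncHom (ball Λ n) (F n s : Measure (List Λ → ℕ)).toSignedMeasure := by
    intro n
    induction n with
    | zero =>
      intro s
      rw [truncHom_ball_zero ⟨_, rfl⟩, truncHom_ball_zero ⟨_, rfl⟩]
    | succ n ih =>
      intro s
      rw [hF (n + 1), hF n, toSignedMeasure_unfoldSem, toSignedMeasure_unfoldSem, ← hF n]
      exact truncHom_lift_theta_congr M ih s
  choose f hf using fun s => exists_limit (fun n => F n s) fun n => hstep n s
  refine ⟨f, fun s => eq_of_truncHom_ball fun n => ?_⟩
  rcases n with _ | n
  · rw [truncHom_ball_zero ⟨f s, rfl⟩, truncHom_ball_zero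
      (isProb_lift_theta M (fun t => ⟨f t, rfl⟩) s)]
  -- At level `n + 1` the limit agrees with the unfolding of `F n`, and `F n` agrees with the limit
  -- at level `n`; by the contraction both unfoldings agree at level `n + 1`.
  · rw [hf s (n + 1), hF n, toSignedMeasure_unfoldSem]
    exact truncHom_lift_theta_congr M (fun t => (hf t n).symm) s

end Existence

/-! ### Polynomials as signed measures on multisets -/

section Multisets

variable {σ : Type*}

open scoped Classical in
/-- The algebra morphism from polynomials to signed measures on multisets that maps an
indeterminate to the point mass at the corresponding one-element multiset. -/
def polyMeasure (σ : Type*) [Countable σ] : MvPolynomial σ ℝ →ₐ[ℝ] SignedMeasure (σ → ℕ) :=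
  MvPolynomial.aeval fun i => VectorMeasure.dirac (Pi.single i 1) 1

theorem polyMeasure_monomial [Countable σ] (m : σ →₀ ℕ) (r : ℝ) :
    polyMeasure σ (MvPolynomial.monomial m r) = VectorMeasure.dirac (m : σ → ℕ) r := by
  classical
  induction m using Finsupp.induction generalizing r with
  | zero =>
    rw [← MvPolynomial.C_apply, ← MvPolynomial.algebraMap_eq, AlgHom.commutes,
      Algebra.algebraMap_eq_smul_one, dirac_eq_smul]
    rfl
  | single_add s k m _ _ ih =>
    have : MvPolynomial.monomial (Finsupp.single s k + m) r =
        (MvPolynomial.X s) ^ k * MvPolynomial.monomial m r := by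
      rw [MvPolynomial.X_pow_eq_monomial, MvPolynomial.monomial_mul, one_mul]
    rw [this, map_mul, map_pow, ih]
    have h2 : polyMeasure σ (MvPolynomial.X s) = VectorMeasure.dirac (Pi.single s 1) 1 := by
      simp only [polyMeasure, MvPolynomial.aeval_X]
    rw [h2, dirac_pow, dirac_mul, one_mul]
    congr 1
    ext t
    by_cases h : t = s
    · subst h; simp
    · simp [h]

theorem polyMeasure_apply [Countable σ] (p : MvPolynomial σ ℝ) (m : σ →₀ ℕ) :
    polyMeasure σ p {(m : σ → ℕ)} = p.coeff m := by
  classical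
  induction p using MvPolynomial.induction_on' with
  | monomial u a =>
    rw [polyMeasure_monomial, MvPolynomial.coeff_monomial]
    split_ifs with h
    · exact VectorMeasure.dirac_apply_of_mem (measurableSet_singleton _) (by simp [h])
    · exact VectorMeasure.dirac_apply_of_notMem (by simpa [DFunLike.coe_fn_eq] using h)
  | add p q hp hq => rw [map_add, MvPolynomial.coeff_add, ← hp, ← hq]; rfl

/-- Coefficients are recovered as the masses of single multisets. Countability of `σ` makes these
singletons measurable. -/
theorem polyMeasure_injective [Countable σ] : Function.Injective (polyMeasure σ) := by
  intro p q h
  ext m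
  rw [← polyMeasure_apply, ← polyMeasure_apply, h]

end Multisets

/-! ### The criterion for equality of semantics -/

section Decision

variable {Λ S : Type*} (M : Automaton Λ S)

theorem lift_act {V : Type*} [CommRing V] [Algebra ℝ V] [WordAlgebra Λ V] (f : S → V)
    (x : List Λ) (p : Free Λ S) :
    lift f (WordAlgebra.act x p) = WordAlgebra.act x (lift f p) := by
  rw [← AlgHom.comp_apply, ← AlgHom.comp_apply]
  congr 1
  refine MvPolynomial.algHom_ext fun i => ?_
  rcases i with w | ⟨w, s⟩ <;>
  · change MvPolynomial.aeval _ (MvPolynomial.rename _ _) = WordAlgebra.act x (lift f _)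
    simp only [MvPolynomial.rename_X, lift, MvPolynomial.aeval_X, Sum.map_inl, Sum.map_inr,
      Sum.elim_inl, Sum.elim_inr, WordAlgebra.act_append, AlgHom.comp_apply]

variable {M} {sem : S → ProbabilityMeasure (List Λ → ℕ)}

/-- On indeterminates, `x · θ` either changes nothing or replaces `w · s` by `w · θ(s)`. In the
latter case the claim is the fixed point equation transported by the action of `w`. -/
theorem IsSemantics.lift_thetaAt (h : IsSemantics M sem) (x : List Λ) (p : Free Λ S) :
    lift (fun t => (sem t : Measure (List Λ → ℕ)).toSignedMeasure) (thetaAt M x p) =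
      lift (fun t => (sem t : Measure (List Λ → ℕ)).toSignedMeasure) p := by
  rw [← AlgHom.comp_apply]
  congr 1
  refine MvPolynomial.algHom_ext fun i => ?_
  rw [AlgHom.comp_apply]
  rcases i with w | ⟨w, s⟩
  · rw [thetaAt_eps]
  · by_cases hx : x <+: w
    · rw [thetaAt_of_prefix M s hx, lift_act, ← h s]
      simp [lift]
    · rw [thetaAt_of_not_prefix M s hx]

theorem IsSemantics.lift_thetaTree (h : IsSemantics M sem) (A : Finset (List Λ))
    (p : MvPolynomial S ℝ) :
    lift (fun t => (sem t : Measure (List Λ → ℕ)).toSignedMeasure) (thetaTree M A p) =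
      lift (fun t => (sem t : Measure (List Λ → ℕ)).toSignedMeasure) (incl Λ S p) := by
  classical
  induction hn : A.card using Nat.strong_induction_on generalizing A with
  | _ n ih =>
    rcases A.eq_empty_or_nonempty with rfl | hne
    · rw [thetaTree_empty]
    · obtain ⟨x, hx, -, hA⟩ := thetaTree_eq M hne
      rw [hA, AlgHom.comp_apply, h.lift_thetaAt,
        ih _ (hn ▸ Finset.card_erase_lt_of_mem hx) _ rfl]

/-- The substitution of `1` for all indeterminates `w · s`. -/
def forgetStates (Λ S : Type*) : Free Λ S →ₐ[ℝ] MvPolynomial (List Λ) ℝ :=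
  (MvPolynomial.mapAlgHom (MvPolynomial.aeval fun _ => 1)).comp
    (MvPolynomial.sumAlgEquiv ℝ (List Λ) (List Λ × S)).toAlgHom

theorem forgetStates_inl (w : List Λ) :
    forgetStates Λ S (MvPolynomial.X (Sum.inl w)) = MvPolynomial.X w := by
  simp [forgetStates]

theorem forgetStates_inr (w : List Λ) (s : S) :
    forgetStates Λ S (MvPolynomial.X (Sum.inr (w, s))) = 1 := by
  simp [forgetStates]

theorem coeff_forgetStates_thetaTree (A : Finset (List Λ)) (m : List Λ →₀ ℕ)
    (p : MvPolynomial S ℝ) :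
    (forgetStates Λ S (thetaTree M A p)).coeff m =
      MvPolynomial.aeval (fun _ => (1 : ℝ)) (dTree M A m p) := by
  simp [forgetStates, dTree, MvPolynomial.coeff_map]

/-- Setting the states to `1` first away from `x` and then at `x` sets all of them to `1`. In
particular the value does not depend on `x`. -/
theorem bone_dAt {A : Finset (List Λ)} (hA : IsTree A) (x : List Λ)
    (m : List Λ →₀ ℕ) (p : MvPolynomial S ℝ) :
    bone Λ S (incl Λ S (dAt M A x m p)) = (forgetStates Λ S (thetaTree M A p)).coeff m := by
  have h₁ : bone Λ S (incl Λ S (dAt M A x m p)) =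
      MvPolynomial.aeval (fun _ => (1 : ℝ))
        (MvPolynomial.rename (fun s => (x, s)) (dAt M A x m p)) := by
    rw [bone, lift, incl, MvPolynomial.aeval_rename, MvPolynomial.aeval_rename]
    congr 2
  rw [h₁, dAt_spec M A hA, coeff_forgetStates_thetaTree, dTreeOne, partialEval,
    MvPolynomial.aeval_rename, ← AlgHom.comp_apply]
  congr 1
  refine MvPolynomial.algHom_ext fun i => ?_
  simp only [AlgHom.comp_apply, MvPolynomial.aeval_X, Function.comp_apply, Sum.elim_inr]
  split_ifs with H
  · simp [bone, lift]
  · simp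

/-- A word of `A` extending `w` would put `w` in `A` by prefix-closure, so the truncation sees only
the empty multiset. -/
theorem truncHom_act_of_mem_boundary {A : Finset (List Λ)} (hA : IsTree A) {w : List Λ}
    (hw : w ∈ boundary A) {μ : SignedMeasure (List Λ → ℕ)} (hμ : IsProb μ) :
    truncHom (A : Set (List Λ)) (WordAlgebra.act w μ) = 1 := by
  change (μ.map (shift w)).map (trunc _) = VectorMeasure.dirac 0 1
  rw [map_map _ (measurable_shift _) (measurable_trunc _)]
  refine map_eq_dirac_of_const hμ ((measurable_trunc _).comp (measurable_shift _)) 0 fun α => ?_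
  ext y
  rw [Function.comp_apply, trunc_apply, Pi.zero_apply, Set.indicator_apply_eq_zero]
  exact fun hy => if_neg fun h => hw.1 (hA y hy w h)

theorem truncHom_act_eps [Countable Λ] {A : Finset (List Λ)} {w : List Λ} (hw : w ∈ A) :
    truncHom (A : Set (List Λ))
      (WordAlgebra.act w (WordAlgebra.eps Λ : SignedMeasure (List Λ → ℕ))) =
        polyMeasure (List Λ) (MvPolynomial.X w) := by
  classical
  have h₁ : (WordAlgebra.eps Λ : SignedMeasure (List Λ → ℕ)) =
      VectorMeasure.dirac (Pi.single [] 1) 1 := by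
    simp only [WordAlgebra.eps]
  have h₂ : polyMeasure (List Λ) (MvPolynomial.X w) = VectorMeasure.dirac (Pi.single w 1) 1 := by
    simp only [polyMeasure, MvPolynomial.aeval_X]
    congr!
  rw [h₁, h₂]
  change (VectorMeasure.map _ (shift w)).map (trunc _) = _
  rw [map_dirac (measurable_shift _), map_dirac (measurable_trunc _)]
  congr 1
  ext y
  rw [trunc_apply]
  change Set.indicator _ (fun y => if w <+: y then
    (Pi.single [] 1 : List Λ → ℕ) (y.drop w.length) else 0) y = _
  by_cases hy : y = w
  · subst hy
    simp [hw]
  · rw [Pi.single_eq_of_ne hy, Set.indicator_apply_eq_zero]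
    intro _
    split_ifs with h
    · obtain ⟨z, rfl⟩ := h
      rw [List.drop_left, Pi.single_eq_of_ne]
      rintro rfl
      simp at hy
    · rfl

/-- Both sides are algebra homomorphisms in `q`, so it suffices to compare them on the
indeterminates `A · ε` and `∂A · S`, the only ones that `θ_A` produces. -/
theorem truncHom_lift [Countable Λ] {A : Finset (List Λ)} (hA : IsTree A)
    {f : S → SignedMeasure (List Λ → ℕ)} (hf : ∀ s, IsProb (f s)) {q : Free Λ S}
    (hq : q ∈ MvPolynomial.supported ℝ
      ({i | (∃ y ∈ A, i = Sum.inl y) ∨ ∃ y ∈ boundary A, ∃ t, i = Sum.inr (y, t)} :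
        Set (List Λ ⊕ (List Λ × S)))) :
    truncHom (A : Set (List Λ)) (lift f q) = polyMeasure (List Λ) (forgetStates Λ S q) := by
  refine hom_congr (f := (truncHom (A : Set (List Λ))).comp (lift f))
    (g := (polyMeasure (List Λ)).comp (forgetStates Λ S)) ?_ hq
  rintro _ (⟨y, hy, rfl⟩ | ⟨y, hy, t, rfl⟩)
  · simp only [AlgHom.comp_apply, forgetStates_inl, lift, MvPolynomial.aeval_X, Sum.elim_inl]
    exact truncHom_act_eps hy
  · simp only [AlgHom.comp_apply, forgetStates_inr, lift, MvPolynomial.aeval_X, Sum.elim_inr,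
      map_one]
    exact truncHom_act_of_mem_boundary hA hy (hf t)

/-- The restriction of the semantics of `p` to a finite tree `A` is given by `θ_A(p)`. -/
theorem IsSemantics.truncHom_lift_incl [Countable Λ] (h : IsSemantics M sem)
    {A : Finset (List Λ)} (hA : IsTree A) (p : MvPolynomial S ℝ) :
    truncHom (A : Set (List Λ))
      (lift (fun t => (sem t : Measure (List Λ → ℕ)).toSignedMeasure) (incl Λ S p)) =
        polyMeasure (List Λ) (forgetStates Λ S (thetaTree M A p)) := by
  rw [← h.lift_thetaTree A p]
  exact truncHom_lift hA (fun t => ⟨sem t, rfl⟩) (thetaTree_mem M A hA p)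

/-- The criterion only quantifies over monomials in `A · ε`; this disposes of all the others. -/
theorem coeff_forgetStates_of_not_subset {A : Finset (List Λ)} (hA : IsTree A)
    {m : List Λ →₀ ℕ} (hm : ¬ m.support ⊆ A) (p : MvPolynomial S ℝ) :
    (forgetStates Λ S (thetaTree M A p)).coeff m = 0 := by
  have hmem : forgetStates Λ S (thetaTree M A p) ∈
      MvPolynomial.supported ℝ (A : Set (List Λ)) := by
    refine hom_mem ?_ (thetaTree_mem M A hA p)
    rintro _ (⟨y, hy, rfl⟩ | ⟨y, hy, t, rfl⟩)
    · rw [forgetStates_inl]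
      exact MvPolynomial.X_mem_supported.2 hy
    · rw [forgetStates_inr]
      exact one_mem _
  by_contra hne
  refine hm fun w hw => ?_
  exact MvPolynomial.mem_supported.1 hmem (MvPolynomial.mem_vars_iff_mem_support w |>.2
    ⟨m, MvPolynomial.mem_support_iff.2 hne, hw⟩)

/-- The criterion constrains a tree only through its boundary words, so each ball needs at least
one; a letter supplies it. -/
theorem replicate_mem_boundary_ball (a : Λ) {n : ℕ} {A : Finset (List Λ)}
    (hA : (A : Set (List Λ)) = ball Λ n) : List.replicate n a ∈ boundary A := by
  have h : ∀ w, w ∈ A ↔ w.length < n := fun w => by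
    rw [← Finset.mem_coe, hA]; rfl
  refine ⟨by simp [h], fun y hy hyA => hy.eq_of_length_le ?_⟩
  rw [h] at hyA
  simpa using hyA

theorem IsSemantics.lift_incl_eq_zero_iff [Finite Λ] [Nonempty Λ] (h : IsSemantics M sem)
    (p : MvPolynomial S ℝ) :
    lift (fun t => (sem t : Measure (List Λ → ℕ)).toSignedMeasure) (incl Λ S p) = 0 ↔
      ∀ A : Finset (List Λ), IsTree A → ∀ x ∈ boundary A, ∀ m : List Λ →₀ ℕ, m.support ⊆ A →
        incl Λ S (dAt M A x m p) ∈ RingHom.ker (bone Λ S) := by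
  constructor
  · intro h₀ A hA x _ m _
    have := h.truncHom_lift_incl hA p
    rw [h₀, map_zero, ← map_zero (polyMeasure (List Λ))] at this
    rw [RingHom.mem_ker, bone_dAt hA, ← polyMeasure_injective this, MvPolynomial.coeff_zero]
  · intro H
    refine eq_of_truncHom_ball fun n => ?_
    -- Finiteness of the alphabet makes the ball a finite tree.
    obtain ⟨A, hAn⟩ := (List.finite_length_lt Λ n).exists_finset_coe
    have hA : IsTree A := fun x hx y hy => by
      rw [← Finset.mem_coe, hAn] at hx ⊢
      exact hy.length_le.trans_lt hx
    have hz : forgetStates Λ S (thetaTree M A p) = 0 := by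
      ext m
      rw [MvPolynomial.coeff_zero]
      by_cases hm : m.support ⊆ A
      · rw [← bone_dAt hA (List.replicate n (Classical.arbitrary Λ))]
        exact H A hA _ (replicate_mem_boundary_ball _ hAn) m hm
      · exact coeff_forgetStates_of_not_subset hA hm p
    have := h.truncHom_lift_incl hA p
    rw [hz, map_zero, hAn] at this
    rw [map_zero]
    exact this

end Decision

end
end PKA

theorem mainTheorem2 {Λ S : Type*} [Finite Λ] [Nonempty Λ] [Finite S] (M : PKA.Automaton Λ S) :
    (∃! sem : S → MeasureTheory.ProbabilityMeasure (List Λ → ℕ), PKA.IsSemantics M sem) ∧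
    ∀ sem : S → MeasureTheory.ProbabilityMeasure (List Λ → ℕ), PKA.IsSemantics M sem →
      ∀ μ ν : PKA.FinSupp S,
        (PKA.semExt sem μ = PKA.semExt sem ν ↔
          ∀ A : Finset (List Λ), PKA.IsTree A → ∀ x ∈ PKA.boundary A,
            ∀ m : List Λ →₀ ℕ, m.support ⊆ A →
              PKA.incl Λ S (PKA.dAt M A x m ((PKA.phi S).symm (μ - ν))) ∈
                RingHom.ker (PKA.bone Λ S)) := by
  refine ⟨?_, fun sem h μ ν => ?_⟩
  · obtain ⟨f, hf⟩ := PKA.exists_isSemantics M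
    exact ⟨f, hf, fun g hg => hg.unique M hf⟩
  -- The extended semantics is linear, so equality for `μ` and `ν` is vanishing for the polynomial
  -- of `μ - ν`.
  · rw [← h.lift_incl_eq_zero_iff, map_sub, map_sub, map_sub, sub_eq_zero]
    rfl
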